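/- Let $\mathbb X,\mathbb Y,\mathbb P$ be finite-dimensional Euclidean spaces, $K:\mathbb X\to\mathbb Y$ a linear operator, $g:\mathbb Y\to\mathbb R\cup\{\infty\}$ a proper lower semicontinuous convex function, and $f:\mathbb X\times\mathbb P\to\mathbb R$ a function such that $f(\cdot,p)$ is convex for every $p\in\mathbb P$. Put $h(x):=g(Kx)$ and $$S(p):=\operatorname{argmin}\{f(x,p)+g(Kx)\mid x\in\mathbb X\}.$$ Let $\bar p\in\mathbb P$, $\bar x\in S(\bar p)$, suppose that $f$ is twice continuously differentiable around $(\bar x,\bar p)$, and suppose that the Robinson constraint qualification $0\in\operatorname{int}(K\bar x+\operatorname{Im}K-\operatorname{dom}g)$ holds. Put $\bar v:=-\nabla_xf(\bar x,\bar p)$. Terminology. A set-valued mapping $S$ is *isolated calm* at $\bar p$ for $\bar x\in S(\bar p)$ if there are $\ell>0$ and neighborhoods $U$ of $\bar x$ and $V$ of $\bar p$ with $\|x-\bar x\|\le\ell\|p-\bar p\|$ for all $p\in V$ and $x\in S(p)\cap U$. For an extended-real-valued function $\varphi$ that is finite at $x$, $\partial\varphi(x)=\{v\mid \varphi(u)-\varphi(x)\ge\langle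 v,u-x\rangle\ \forall u\}$; $\varphi^*(v)=\sup_x\{\langle v,x\rangle-\varphi(x)\}$; the second subderivative is $$d^2\varphi(x|v)(w)=\liminf_{w'\to w,\,t\downarrow0}\frac{\varphi(x+tw')-\varphi(x)-t\langle v,w'\rangle}{\frac12t^2},$$ and $\operatorname{Ker}d^2\varphi(x|v)=\{w\mid d^2\varphi(x|v)(w)=0\}$. The function $\varphi$ has *quadratic growth* at $x$ for $v\in\partial\varphi(x)$ if there are $c,\varepsilon>0$ with $\varphi(u)\ge\varphi(x)+\langle v,u-x\rangle+\frac c2\,d\bigl(u;(\partial\varphi)^{-1}(v)\bigr)^2$ whenever $\|u-x\|<\varepsilon$. The tangent (contingent) cone $T_\Omega(x)$ is the set of all $w$ for which there are $t_k\downarrow0$ and $w_k\to w$ with $x+t_kw_k\in\Omega$. **Theorem.** (a) If $\operatorname{Ker}\nabla^2_{xx}f(\bar x,\bar p)\cap\operatorname{Ker}d^2h(\bar x|\bar v)=\{0\}$, then $S$ is isolated calm at $\bar p$ for $\bar x$. (b) Let $\bar y\in\partial g(K\bar x)$ satisfy $K^*\bar y=-\nabla_xf(\bar x,\bar p)$,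 and suppose that $g$ has quadratic growth at $K\bar x$ for $\bar y$. If $\operatorname{Ker}\nabla^2_{xx}f(\bar x,\bar p)\cap K^{-1}\bigl(T_{\partial g^*(\bar y)}(K\bar x)\bigr)=\{0\}$, then $S$ is isolated calm at $\bar p$ for $\bar x$. -/

import Mathlib

open Filter Topology Set

noncomputable section

namespace CompositeCalm

section ExtendedReal

variable {E : Type*} [NormedAddCommGroup E] [InnerProductSpace ℝ E]

/-- A proper lower semicontinuous convex function with values in `ℝ ∪ {∞}`
(convexity is convexity of the epigraph). -/
structure ProperLscConvex (φ : E → EReal) : Prop where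
  ne_bot : ∀ x, φ x ≠ ⊥
  exists_ne_top : ∃ x, φ x ≠ ⊤
  lsc : LowerSemicontinuous φ
  convex : Convex ℝ {q : E × ℝ | φ q.1 ≤ (q.2 : EReal)}

/-- The effective domain of a function with values in `ℝ ∪ {∞}`. -/
def effDomain (φ : E → EReal) : Set E := {x | φ x ≠ ⊤}

/-- The set of global minimizers; by the usual convention a minimizer has a finite value. -/
def argmin (φ : E → EReal) : Set E := {x | φ x ≠ ⊤ ∧ ∀ u, φ x ≤ φ u}

/-- The subdifferential of convex analysis, `φ x + ⟪v, u - x⟫ ≤ φ u` for all `u`.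
For proper `φ` it is empty at every point with `φ x = ⊤`. -/
def subdifferential (φ : E → EReal) (x : E) : Set E :=
  {v | ∀ u, φ x + ((inner ℝ v (u - x) : ℝ) : EReal) ≤ φ u}

/-- The Fenchel conjugate `φ* v = sup_x ⟪v, x⟫ - φ x`. -/
def conjugate (φ : E → EReal) (v : E) : EReal :=
  ⨆ x, ((inner ℝ v x : ℝ) : EReal) - φ x

/-- The second subderivative `d²φ(x | v)(w)`: the lower limit, as `t ↓ 0` and `w' → w`, of
`(φ (x + t w') - φ x - t ⟪v, w'⟫) / (t² / 2)`. -/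
def secondSubderiv (φ : E → EReal) (x v w : E) : EReal :=
  liminf (fun q : ℝ × E =>
      (φ (x + q.1 • q.2) - φ x - ((q.1 * inner ℝ v q.2 : ℝ) : EReal)) /
        ((q.1 ^ 2 / 2 : ℝ) : EReal))
    (𝓝[>] (0 : ℝ) ×ˢ 𝓝 w)

/-- The kernel of the second subderivative. -/
def kerSecondSubderiv (φ : E → EReal) (x v : E) : Set E :=
  {w | secondSubderiv φ x v w = 0}

/-- The quadratic growth condition of `φ` at `x` for `v ∈ ∂φ(x)`; the distance is taken to the
set `(∂φ)⁻¹(v)`. -/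
def QuadraticGrowth (φ : E → EReal) (x v : E) : Prop :=
  ∃ c > (0 : ℝ), ∃ ε > (0 : ℝ), ∀ u ∈ Metric.ball x ε,
    φ x + ((inner ℝ v (u - x) +
        c / 2 * Metric.infDist u {z | v ∈ subdifferential φ z} ^ 2 : ℝ) : EReal) ≤ φ u

end ExtendedReal

/-- Isolated calmness of a set-valued mapping `S` at `p₀` for `x₀ ∈ S p₀`. -/
def IsolatedCalm {P X : Type*} [NormedAddCommGroup P] [NormedAddCommGroup X]
    (S : P → Set X) (p₀ : P) (x₀ : X) : Prop :=
  x₀ ∈ S p₀ ∧ ∃ ℓ > (0 : ℝ), ∃ U ∈ 𝓝 x₀, ∃ V ∈ 𝓝 p₀,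
    ∀ p ∈ V, ∀ x ∈ S p ∩ U, ‖x - x₀‖ ≤ ℓ * ‖p - p₀‖

section Composite

variable {X Y P : Type*}
  [NormedAddCommGroup X] [InnerProductSpace ℝ X] [FiniteDimensional ℝ X]
  [NormedAddCommGroup Y] [InnerProductSpace ℝ Y]

/-- The partial gradient `∇ₓ f(x, p)`. -/
def gradX (f : X → P → ℝ) (x : X) (p : P) : X :=
  haveI : CompleteSpace X := FiniteDimensional.complete ℝ X
  gradient (fun x' => f x' p) x

/-- The partial Hessian `∇²ₓₓ f(x, p)`, as a linear operator on `X`. -/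
def hessXX (f : X → P → ℝ) (x : X) (p : P) : X →L[ℝ] X :=
  fderiv ℝ (fun x' => gradX f x' p) x

/-- The optimal solution mapping `p ↦ argmin_x f(x, p) + g(K x)`. -/
def solutionMap (f : X → P → ℝ) (g : Y → EReal) (K : X →ₗ[ℝ] Y) (p : P) : Set X :=
  argmin (fun x => (f x p : EReal) + g (K x))

/-- The Robinson constraint qualification `0 ∈ int (K x + Im K - dom g)`. -/
def RobinsonCQ (g : Y → EReal) (K : X →ₗ[ℝ] Y) (x : X) : Prop :=
  (0 : Y) ∈ interior {z | ∃ u : X, ∃ y ∈ effDomain g, z = K x + K u - y}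

end Composite

end CompositeCalm

end

open CompositeCalm

namespace CompositeCalm

/-! ### Partial gradient and Hessian of the smooth part. -/

section Smooth

variable {X : Type*} [NormedAddCommGroup X] [InnerProductSpace ℝ X]

/-! If isolated calmness fails, there are solutions x_n = x₀ + t_n w_n for p_n with t_n ↓ 0, w_n → w
≠ 0 and p_n - p₀ = o(t_n). Optimality gives subgradients -∇ₓf(x_n, p_n) and v = -∇ₓf(x₀, p₀) of h =
g ∘ K at x_n and x₀. Their monotonicity, divided by t_n², yields ⟨Hw, w⟩ ≤ 0 in the limit, so Hw = 0
because the Hessian H is symmetric and positive semidefinite. The subgradient inequality at x_n then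
reads h(x_n) ≤ h(x₀) + t_n⟨v, w_n⟩ + o(t_n²) (`hessXX_apply_eq_zero_and_second_order_bound`).

This bound drives both parts. For (a) it forces d²h(x₀|v)(w) = 0. For (b), quadratic growth turns it
into d(Kx_n; (∂g)⁻¹(y₀)) = o(t_n), so Kw is tangent to (∂g)⁻¹(y₀), a subset of ∂g*(y₀). Either way
the kernel condition gives w = 0, a contradiction. -/

lemma inner_gradX {P : Type*} [FiniteDimensional ℝ X] (f : X → P → ℝ) (x : X) (p : P) (d : X) :
    inner ℝ (gradX f x p) d = fderiv ℝ (fun x' => f x' p) x d := by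
  have : CompleteSpace X := FiniteDimensional.complete ℝ X
  simp only [gradX, gradient, InnerProductSpace.toDual_symm_apply]

lemma le_fderiv_of_forall_mul_le {F : X → ℝ} {x d : X} {c : ℝ} (hF : DifferentiableAt ℝ F x)
    (h : ∀ t ∈ Ioo (0 : ℝ) 1, t * c ≤ F (x + t • d) - F x) : c ≤ fderiv ℝ F x d := by
  refine ge_of_tendsto (hF.hasFDerivAt.lim_real d) ?_
  filter_upwards [eventually_gt_atTop 1] with s hs
  have hs0 : 0 < s := by linarith
  have := h s⁻¹ ⟨inv_pos.2 hs0, inv_lt_one_of_one_lt₀ hs⟩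
  calc c = s * (s⁻¹ * c) := by field_simp
    _ ≤ _ := mul_le_mul_of_nonneg_left this hs0.le

lemma fderiv_sub_le_of_convexOn {F : X → ℝ} (hconv : ConvexOn ℝ univ F) {x : X}
    (hF : DifferentiableAt ℝ F x) (u : X) : fderiv ℝ F x (u - x) ≤ F u - F x := by
  have := le_fderiv_of_forall_mul_le (c := -(F u - F x)) (d := u - x) hF.neg (fun t ht => by
    have := hconv.2 (mem_univ x) (mem_univ u) (sub_nonneg.2 ht.2.le) ht.1.le (by ring)
    have e : (1 - t) • x + t • u = x + t • (u - x) := by module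
    rw [e] at this
    simp only [smul_eq_mul, Pi.neg_apply] at this ⊢
    linarith)
  rw [fderiv_neg, neg_apply] at this
  linarith

variable {P : Type*} [NormedAddCommGroup P] [InnerProductSpace ℝ P] {f : X → P → ℝ} {x₀ : X} {p₀ : P}

lemma eventually_differentiableAt
    (hf : ContDiffAt ℝ 2 (fun q : X × P => f q.1 q.2) (x₀, p₀)) :
    ∀ᶠ q in 𝓝 (x₀, p₀), DifferentiableAt ℝ (fun q : X × P => f q.1 q.2) q := by
  filter_upwards [hf.eventually (by simp)] with q hq using hq.differentiableAt (by simp)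

lemma fderiv_fst_apply {q : X × P} (h : DifferentiableAt ℝ (fun q : X × P => f q.1 q.2) q)
    (d : X) :
    fderiv ℝ (fun x' => f x' q.2) q.1 d = fderiv ℝ (fun q : X × P => f q.1 q.2) q (d, 0) := by
  have h1 : HasFDerivAt (fun x' : X => (x', q.2)) (ContinuousLinearMap.inl ℝ X P) q.1 :=
    hasFDerivAt_prodMk_left q.1 q.2
  have h2 := HasFDerivAt.comp (g := fun q : X × P => f q.1 q.2) q.1 h.hasFDerivAt h1
  have h3 : HasFDerivAt (fun x' => f x' q.2) _ q.1 := h2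
  rw [h3.fderiv]
  simp

lemma differentiableAt_left {q : X × P}
    (h : DifferentiableAt ℝ (fun q : X × P => f q.1 q.2) q) :
    DifferentiableAt ℝ (fun x' => f x' q.2) q.1 :=
  DifferentiableAt.comp (g := fun q : X × P => f q.1 q.2) q.1 h
    (hasFDerivAt_prodMk_left (𝕜 := ℝ) q.1 q.2).differentiableAt

variable [FiniteDimensional ℝ X]

lemma differentiableAt_gradX
    (hf : ContDiffAt ℝ 2 (fun q : X × P => f q.1 q.2) (x₀, p₀)) :
    DifferentiableAt ℝ (fun q : X × P => gradX f q.1 q.2) (x₀, p₀) := by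
  -- In an orthonormal basis the coordinates of the partial gradient are the joint derivative
  -- applied to (b i, 0), which is C¹.
  let b := stdOrthonormalBasis ℝ X
  have h1 : DifferentiableAt ℝ (fderiv ℝ (fun q : X × P => f q.1 q.2)) (x₀, p₀) :=
    (hf.fderiv_right (m := 1) (by norm_num)).differentiableAt (by simp)
  have h2 : DifferentiableAt ℝ
      (fun q => ∑ i, (fderiv ℝ (fun q : X × P => f q.1 q.2) q (b i, 0)) • b i) (x₀, p₀) := by
    fun_prop
  refine h2.congr_of_eventuallyEq ?_
  filter_upwards [eventually_differentiableAt hf] with q hq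
  rw [← b.sum_repr' (gradX f q.1 q.2)]
  refine Finset.sum_congr rfl fun i _ => ?_
  rw [real_inner_comm, inner_gradX, fderiv_fst_apply hq]

lemma hasFDerivAt_gradX_left
    (hf : ContDiffAt ℝ 2 (fun q : X × P => f q.1 q.2) (x₀, p₀)) :
    HasFDerivAt (fun x => gradX f x p₀) (hessXX f x₀ p₀) x₀ :=
  (DifferentiableAt.comp (g := fun q : X × P => gradX f q.1 q.2) x₀ (differentiableAt_gradX hf)
    (hasFDerivAt_prodMk_left (𝕜 := ℝ) x₀ p₀).differentiableAt).hasFDerivAt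

lemma fderiv_gradX_apply_inl
    (hf : ContDiffAt ℝ 2 (fun q : X × P => f q.1 q.2) (x₀, p₀)) (w : X) :
    fderiv ℝ (fun q : X × P => gradX f q.1 q.2) (x₀, p₀) (w, 0) = hessXX f x₀ p₀ w := by
  have h := HasFDerivAt.comp (g := fun q : X × P => gradX f q.1 q.2) x₀
    (differentiableAt_gradX hf).hasFDerivAt (hasFDerivAt_prodMk_left (𝕜 := ℝ) x₀ p₀)
  have h' : HasFDerivAt (fun x => gradX f x p₀) _ x₀ := h
  rw [← h'.unique (hasFDerivAt_gradX_left hf)]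
  simp

lemma inner_hessXX_comm
    (hf : ContDiffAt ℝ 2 (fun q : X × P => f q.1 q.2) (x₀, p₀)) (u v : X) :
    inner ℝ (hessXX f x₀ p₀ u) v = inner ℝ (hessXX f x₀ p₀ v) u := by
  have hF : ContDiffAt ℝ 2 (fun x => f x p₀) x₀ :=
    ContDiffAt.comp (g := fun q : X × P => f q.1 q.2) x₀ hf
      (contDiff_prodMk_left p₀).contDiffAt
  have hD : DifferentiableAt ℝ (fderiv ℝ (fun x => f x p₀)) x₀ :=
    (hF.fderiv_right (m := 1) (by norm_num)).differentiableAt (by simp)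
  have key : ∀ u v, inner ℝ (hessXX f x₀ p₀ u) v = fderiv ℝ (fderiv ℝ (fun x => f x p₀)) x₀ u v := by
    intro u v
    have h1 := (hasFDerivAt_gradX_left hf).inner ℝ (hasFDerivAt_const v x₀)
    have h2 := hD.hasFDerivAt.clm_apply (hasFDerivAt_const v x₀)
    simp only [inner_gradX] at h1
    have := DFunLike.congr_fun (h1.unique h2) u
    simpa [inner_gradX] using this
  rw [key, key]
  exact (hF.isSymmSndFDerivAt (by simp)).eq u v

lemma inner_hessXX_self_nonneg (hconv : ConvexOn ℝ univ (fun x => f x p₀))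
    (hf : ContDiffAt ℝ 2 (fun q : X × P => f q.1 q.2) (x₀, p₀)) (w : X) :
    0 ≤ inner ℝ (hessXX f x₀ p₀ w) w := by
  have h0 := (hasFDerivAt_gradX_left hf).lim_real w
  have h1 := h0.inner (𝕜 := ℝ) (tendsto_const_nhds (x := w))
  refine ge_of_tendsto h1 ?_
  have hd : ∀ᶠ x in 𝓝 x₀, DifferentiableAt ℝ (fun x' => f x' p₀) x := by
    have : Tendsto (fun x => (x, p₀)) (𝓝 x₀) (𝓝 (x₀, p₀)) :=
      (Continuous.prodMk_left p₀).tendsto x₀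
    filter_upwards [this.eventually (eventually_differentiableAt hf)] with x hx
    exact differentiableAt_left hx
  have hlim : Tendsto (fun c : ℝ => x₀ + c⁻¹ • w) atTop (𝓝 x₀) := by
    simpa using (tendsto_const_nhds (x := x₀)).add
      ((tendsto_inv_atTop_zero (𝕜 := ℝ)).smul (tendsto_const_nhds (x := w)))
  filter_upwards [hlim.eventually hd, eventually_gt_atTop 0] with c hc hc0
  have e1 := fderiv_sub_le_of_convexOn hconv hc x₀
  have e2 := fderiv_sub_le_of_convexOn hconv hd.self_of_nhds (x₀ + c⁻¹ • w)
  rw [← inner_gradX] at e1 e2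
  have a1 : x₀ - (x₀ + c⁻¹ • w) = -(c⁻¹ • w) := by abel
  rw [a1, inner_neg_right, inner_smul_right] at e1
  rw [add_sub_cancel_left, inner_smul_right] at e2
  rw [inner_smul_left, inner_sub_left]
  simp only [conj_trivial]
  refine mul_nonneg hc0.le (sub_nonneg.2 ?_)
  exact le_of_mul_le_mul_left (by linarith) (inv_pos.2 hc0)

end Smooth

/-- Perturb w in the direction -Hw: if Hw ≠ 0, the form would become negative for a small step. -/
lemma apply_eq_zero_of_inner_self_nonpos {X : Type*} [NormedAddCommGroup X] [InnerProductSpace ℝ X]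
    {H : X →L[ℝ] X} (hsymm : ∀ u v, inner ℝ (H u) v = inner ℝ (H v) u)
    (hnonneg : ∀ u, 0 ≤ inner ℝ (H u) u) {w : X} (hw : inner ℝ (H w) w ≤ 0) : H w = 0 := by
  set A : ℝ := inner ℝ (H w) (H w) with hA
  set B : ℝ := inner ℝ (H (H w)) (H w) with hB
  have hB0 : 0 ≤ B := hnonneg _
  have h : ∀ s : ℝ, 0 ≤ -2 * s * A + s ^ 2 * B := by
    intro s
    have := hnonneg (w - s • H w)
    simp only [map_sub, map_smul, inner_sub_left, inner_sub_right, inner_smul_left,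
      inner_smul_right, conj_trivial] at this
    rw [hsymm (H w) w, ← hA, ← hB] at this
    nlinarith
  -- Nearly the minimizing step A / B; the shift covers B = 0.
  have h1 := h (A / (B + 1))
  have e : -2 * (A / (B + 1)) * A + (A / (B + 1)) ^ 2 * B = -(A ^ 2 * (B + 2) / (B + 1) ^ 2) := by
    field_simp
    ring
  rw [e, neg_nonneg] at h1
  have h2 : A ^ 2 * (B + 2) ≤ 0 := by
    by_contra hc
    exact absurd h1 (not_le.2 (div_pos (not_le.1 hc) (by positivity)))
  have h3 : A = 0 := by
    have : A ^ 2 = 0 := le_antisymm (by nlinarith [sq_nonneg A]) (sq_nonneg A)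
    exact pow_eq_zero_iff two_ne_zero |>.1 this
  exact inner_self_eq_zero.1 h3

/-! ### Optimality condition and blow-up sequence. -/

section Subgradient

lemma exists_coe_eq_of_mem_argmin {X : Type*} {F : X → ℝ} {h : X → EReal} (hbot : ∀ x, h x ≠ ⊥) {x : X}
    (hx : x ∈ argmin (fun x => (F x : EReal) + h x)) : ∃ a : ℝ, h x = a := by
  have htop : h x ≠ ⊤ := fun e => hx.1 (by simp [e])
  exact ⟨(h x).toReal, (EReal.coe_toReal htop (hbot x)).symm⟩

variable {X P : Type*} [NormedAddCommGroup X] [InnerProductSpace ℝ X]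

/-- Compare the minimizer with points of the segment towards u: convexity bounds h there by the
chord, and dividing by t → 0 leaves the derivative of f. -/
lemma neg_gradX_mem_subdifferential [FiniteDimensional ℝ X] {f : X → P → ℝ} {h : X → EReal}
    (hbot : ∀ x, h x ≠ ⊥) (hconv : Convex ℝ {q : X × ℝ | h q.1 ≤ (q.2 : EReal)}) {x : X} {p : P}
    (hd : DifferentiableAt ℝ (fun x' => f x' p) x)
    (hx : x ∈ argmin (fun x => (f x p : EReal) + h x)) :
    -gradX f x p ∈ subdifferential h x := by
  obtain ⟨a, ha⟩ := exists_coe_eq_of_mem_argmin hbot hx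
  intro u
  by_cases htop : h u = ⊤
  · simp [htop]
  obtain ⟨b, hb⟩ : ∃ b : ℝ, h u = b := ⟨_, (EReal.coe_toReal htop (hbot u)).symm⟩
  have key : a - b ≤ fderiv ℝ (fun x' => f x' p) x (u - x) := by
    refine le_fderiv_of_forall_mul_le hd fun t ht => ?_
    have hmem := hconv (x := (x, a)) (by simp [ha]) (y := (u, b)) (by simp [hb])
      (sub_nonneg.2 ht.2.le) ht.1.le (by ring)
    have e : (1 - t) • x + t • u = x + t • (u - x) := by module
    simp only [Prod.smul_mk, Prod.mk_add_mk, e, smul_eq_mul, Set.mem_ofPred] at hmem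
    have hmin := hx.2 (x + t • (u - x))
    simp only [ha] at hmin
    have := hmin.trans (add_le_add_right hmem _)
    norm_cast at this
    linarith
  rw [ha, hb, inner_neg_left, inner_gradX]
  norm_cast
  linarith

end Subgradient

lemma exists_seq_of_not_isolatedCalm {P X : Type*} [NormedAddCommGroup P] [NormedSpace ℝ P]
    [NormedAddCommGroup X] [NormedSpace ℝ X] [FiniteDimensional ℝ X] {S : P → Set X} {p₀ : P}
    {x₀ : X} (hx₀ : x₀ ∈ S p₀) (hS : ¬ IsolatedCalm S p₀ x₀) :
    ∃ (w : X) (t : ℕ → ℝ) (ws : ℕ → X) (ps : ℕ → P), w ≠ 0 ∧ (∀ n, 0 < t n) ∧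
      Tendsto t atTop (𝓝 0) ∧ Tendsto ws atTop (𝓝 w) ∧
      Tendsto (fun n => (t n)⁻¹ • (ps n - p₀)) atTop (𝓝 0) ∧
      ∀ n, x₀ + t n • ws n ∈ S (ps n) := by
  have h : ∀ n : ℕ, ∃ (p : P) (x : X), x ∈ S p ∧ ‖x - x₀‖ < 1 / ((n : ℝ) + 1) ∧
      ((n : ℝ) + 1) * ‖p - p₀‖ < ‖x - x₀‖ := by
    intro n
    have hn : (0 : ℝ) < 1 / ((n : ℝ) + 1) := by positivity
    by_contra hc
    push Not at hc
    -- No restriction on p is needed: when the estimate fails, ‖p - p₀‖ is already smaller than ‖x -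
    -- x₀‖ / (n + 1).
    refine hS ⟨hx₀, n + 1, by positivity, _, Metric.ball_mem_nhds x₀ hn, univ, univ_mem, ?_⟩
    rintro p - x ⟨hxS, hxU⟩
    exact hc p x hxS (by simpa [dist_eq_norm] using hxU)
  choose ps xs hxS hxlt hplt using h
  have htpos : ∀ n, 0 < ‖xs n - x₀‖ := fun n =>
    lt_of_le_of_lt (by positivity) (hplt n)
  have ht0 : Tendsto (fun n => ‖xs n - x₀‖) atTop (𝓝 0) :=
    squeeze_zero (fun n => norm_nonneg _) (fun n => (hxlt n).le)
      tendsto_one_div_add_atTop_nhds_zero_nat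
  have hp0 : Tendsto (fun n => ‖xs n - x₀‖⁻¹ • (ps n - p₀)) atTop (𝓝 0) := by
    refine squeeze_zero_norm (fun n => ?_) tendsto_one_div_add_atTop_nhds_zero_nat
    rw [norm_smul, norm_inv, norm_norm, inv_mul_le_iff₀ (htpos n), mul_one_div,
      le_div_iff₀ (by positivity), mul_comm]
    exact (hplt n).le
  have hsphere : ∀ n, ‖xs n - x₀‖⁻¹ • (xs n - x₀) ∈ Metric.sphere (0 : X) 1 := fun n => by
    simp [norm_smul, (htpos n).ne']
  have : ProperSpace X := FiniteDimensional.proper ℝ X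
  obtain ⟨w, hw, φ, hφ, hlim⟩ := (isCompact_sphere (0 : X) 1).tendsto_subseq hsphere
  refine ⟨w, _, _, ps ∘ φ, ?_, fun n => htpos (φ n), ht0.comp hφ.tendsto_atTop, hlim,
    hp0.comp hφ.tendsto_atTop, fun n => ?_⟩
  · rintro rfl
    simp at hw
  · have e : x₀ + ‖xs (φ n) - x₀‖ • ‖xs (φ n) - x₀‖⁻¹ • (xs (φ n) - x₀) = xs (φ n) := by
      rw [smul_inv_smul₀ (htpos _).ne']
      abel
    simpa [e] using hxS (φ n)

/-! ### Second-order consequences along the sequence. -/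

section Growth

variable {X P : Type*}
  [NormedAddCommGroup X] [InnerProductSpace ℝ X] [FiniteDimensional ℝ X]
  [NormedAddCommGroup P] [InnerProductSpace ℝ P]

lemma hessXX_apply_eq_zero_and_second_order_bound {f : X → P → ℝ} {h : X → EReal} {x₀ : X}
    {p₀ : P} (hfconv : ConvexOn ℝ univ (fun x => f x p₀))
    (hf : ContDiffAt ℝ 2 (fun q : X × P => f q.1 q.2) (x₀, p₀))
    (hbot : ∀ x, h x ≠ ⊥) (hconv : Convex ℝ {q : X × ℝ | h q.1 ≤ (q.2 : EReal)})
    {a : ℝ} (ha : h x₀ = a) (hv : -gradX f x₀ p₀ ∈ subdifferential h x₀)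
    {w : X} {t : ℕ → ℝ} {ws : ℕ → X} {ps : ℕ → P} (ht : ∀ n, 0 < t n)
    (ht0 : Tendsto t atTop (𝓝 0)) (hws : Tendsto ws atTop (𝓝 w))
    (hps : Tendsto (fun n => (t n)⁻¹ • (ps n - p₀)) atTop (𝓝 0))
    (hS : ∀ n, x₀ + t n • ws n ∈ argmin (fun x => (f x (ps n) : EReal) + h x)) :
    hessXX f x₀ p₀ w = 0 ∧ ∃ r : ℕ → ℝ, Tendsto r atTop (𝓝 0) ∧
      ∀ᶠ n in atTop, h (x₀ + t n • ws n) ≤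
        ((a + t n * inner ℝ (-gradX f x₀ p₀) (ws n) + t n ^ 2 * r n : ℝ) : EReal) := by
  set d : ℕ → X × P := fun n => (t n • ws n, ps n - p₀) with hd
  have hcd : Tendsto (fun n => (t n)⁻¹ • d n) atTop (𝓝 (w, 0)) := by
    have : (fun n => (t n)⁻¹ • d n) = fun n => (ws n, (t n)⁻¹ • (ps n - p₀)) := by
      funext n
      simp [hd, smul_smul, (ht n).ne']
    rw [this]
    exact hws.prodMk_nhds hps
  have hd0 : Tendsto d atTop (𝓝 0) := by
    have := ht0.smul hcd
    rw [zero_smul] at this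
    refine this.congr fun n => ?_
    rw [smul_inv_smul₀ (ht n).ne']
  have hq : ∀ n, (x₀, p₀) + d n = (x₀ + t n • ws n, ps n) := fun n => by simp [hd]
  have hqlim : Tendsto (fun n => (x₀ + t n • ws n, ps n)) atTop (𝓝 (x₀, p₀)) := by
    have := (tendsto_const_nhds (x := (x₀, p₀))).add hd0
    simpa only [hq, add_zero] using this
  -- The scaled increments tend to (w, 0), so only the Hessian in x survives in the limit.
  have hG := (hasFDerivWithinAt_univ.2 (differentiableAt_gradX hf).hasFDerivAt).lim hd0
    (Eventually.of_forall fun _ => mem_univ _) hcd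
  simp only [hq, fderiv_gradX_apply_inl hf] at hG
  set r : ℕ → ℝ := fun n =>
    -inner ℝ ((t n)⁻¹ • (gradX f (x₀ + t n • ws n) (ps n) - gradX f x₀ p₀)) (ws n) with hr
  have hrlim : Tendsto r atTop (𝓝 (-inner ℝ (hessXX f x₀ p₀ w) w)) := (hG.inner hws).neg
  have hbound : ∀ᶠ n in atTop, 0 ≤ r n ∧ h (x₀ + t n • ws n) ≤
        ((a + t n * inner ℝ (-gradX f x₀ p₀) (ws n) + t n ^ 2 * r n : ℝ) : EReal) := by
    filter_upwards [hqlim.eventually (eventually_differentiableAt hf)] with n hn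
    obtain ⟨b, hb⟩ := exists_coe_eq_of_mem_argmin hbot (hS n)
    -- `h1` alone is the upper bound on h; added to `h2` it gives `0 ≤ r n`.
    have h1 := neg_gradX_mem_subdifferential hbot hconv (differentiableAt_left hn) (hS n) x₀
    have h2 := hv (x₀ + t n • ws n)
    rw [ha, hb] at h1 h2
    norm_cast at h1 h2
    have e1 : x₀ - (x₀ + t n • ws n) = -(t n • ws n) := by abel
    rw [e1, inner_neg_left, inner_neg_right, inner_smul_right] at h1
    rw [add_sub_cancel_left, inner_neg_left, inner_smul_right] at h2
    have hr' : t n ^ 2 * r n = t n * inner ℝ (gradX f x₀ p₀) (ws n) -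
        t n * inner ℝ (gradX f (x₀ + t n • ws n) (ps n)) (ws n) := by
      have := (ht n).ne'
      simp only [hr, inner_smul_left, inner_sub_left, conj_trivial]
      field_simp
      ring
    constructor
    · refine nonneg_of_mul_nonneg_right (a := t n ^ 2) ?_ (pow_pos (ht n) 2)
      rw [hr']
      linarith
    · rw [hb, hr', inner_neg_left]
      norm_cast
      linarith
  have hw0 : hessXX f x₀ p₀ w = 0 := by
    refine apply_eq_zero_of_inner_self_nonpos (inner_hessXX_comm hf)
      (inner_hessXX_self_nonneg hfconv hf) ?_
    have := ge_of_tendsto hrlim (hbound.mono fun n hn => hn.1)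
    linarith
  refine ⟨hw0, r, by simpa [hw0] using hrlim, hbound.mono fun n hn => hn.2⟩

end Growth

/-- The subgradient inequality makes every difference quotient nonnegative, while along the given
sequence the quotients are at most 2 r_n → 0. -/
lemma mem_kerSecondSubderiv_of_second_order_bound {X : Type*} [NormedAddCommGroup X]
    [InnerProductSpace ℝ X] {h : X → EReal} {x₀ v w : X} {a : ℝ} (ha : h x₀ = a)
    (hv : v ∈ subdifferential h x₀) {t : ℕ → ℝ} {ws : ℕ → X} {r : ℕ → ℝ} (ht : ∀ n, 0 < t n)
    (ht0 : Tendsto t atTop (𝓝 0)) (hws : Tendsto ws atTop (𝓝 w))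
    (hr : Tendsto r atTop (𝓝 0))
    (hb : ∀ᶠ n in atTop, h (x₀ + t n • ws n) ≤
        ((a + t n * inner ℝ v (ws n) + t n ^ 2 * r n : ℝ) : EReal)) :
    w ∈ kerSecondSubderiv h x₀ v := by
  refine le_antisymm ?_ ?_
  · have hlim : Tendsto (fun n => (t n, ws n)) atTop (𝓝[>] (0 : ℝ) ×ˢ 𝓝 w) :=
      (tendsto_nhdsWithin_iff.2 ⟨ht0, Eventually.of_forall ht⟩).prodMk hws
    refine hlim.liminf_le_liminf_comp.trans ?_
    have hr2 : Tendsto (fun n => ((2 * r n : ℝ) : EReal)) atTop (𝓝 0) := by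
      have := hr.const_mul 2
      rw [mul_zero] at this
      exact (continuous_coe_real_ereal.tendsto 0).comp this
    rw [← hr2.liminf_eq]
    refine liminf_le_liminf ?_
    filter_upwards [hb] with n hn
    have hpos : (0 : ℝ) < t n ^ 2 / 2 := half_pos (pow_pos (ht n) 2)
    simp only [Function.comp_apply, ha]
    rw [EReal.div_le_iff_le_mul (by exact_mod_cast hpos) (EReal.coe_ne_top _)]
    calc _ ≤ ((a + t n * inner ℝ v (ws n) + t n ^ 2 * r n : ℝ) : EReal) - (a : EReal) -
          ((t n * inner ℝ v (ws n) : ℝ) : EReal) :=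
          EReal.sub_le_sub (EReal.sub_le_sub hn le_rfl) le_rfl
      _ ≤ _ := by
        norm_cast
        linarith
  · refine le_liminf_of_le (by isBoundedDefault) ?_
    have hpos : ∀ᶠ q : ℝ × X in 𝓝[>] (0 : ℝ) ×ˢ 𝓝 w, 0 < q.1 :=
      tendsto_fst.eventually self_mem_nhdsWithin
    filter_upwards [hpos] with q hq
    have h1 := hv (x₀ + q.1 • q.2)
    rw [add_sub_cancel_left, inner_smul_right, ha] at h1
    refine EReal.div_nonneg ?_ (by exact_mod_cast (half_pos (pow_pos hq 2)).le)
    rw [ha]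
    calc (0 : EReal) ≤ ((a : EReal) + ((q.1 * inner ℝ v q.2 : ℝ) : EReal)) - (a : EReal) -
          ((q.1 * inner ℝ v q.2 : ℝ) : EReal) := by
          norm_cast
          simp
      _ ≤ _ := EReal.sub_le_sub (EReal.sub_le_sub h1 le_rfl) le_rfl

/-- A subgradient y at z makes z attain the supremum defining φ*(y); the same z is a competitor in
φ*(u). -/
lemma mem_subdifferential_conjugate {E : Type*} [NormedAddCommGroup E] [InnerProductSpace ℝ E]
    {φ : E → EReal} (hbot : ∀ x, φ x ≠ ⊥) (hne : ∃ x, φ x ≠ ⊤) {y z : E}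
    (h : y ∈ subdifferential φ z) : z ∈ subdifferential (conjugate φ) y := by
  have htop : φ z ≠ ⊤ := by
    intro e
    obtain ⟨x, hx⟩ := hne
    have := h x
    rw [e, EReal.top_add_coe, top_le_iff] at this
    exact hx this
  obtain ⟨a, ha⟩ : ∃ a : ℝ, φ z = a := ⟨_, (EReal.coe_toReal htop (hbot z)).symm⟩
  have hle : conjugate φ y ≤ ((inner ℝ y z - a : ℝ) : EReal) := by
    refine iSup_le fun x => ?_
    have hx := h x
    by_cases hxt : φ x = ⊤
    · simp [hxt]
    obtain ⟨b, hb⟩ : ∃ b : ℝ, φ x = b := ⟨_, (EReal.coe_toReal hxt (hbot x)).symm⟩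
    rw [ha, hb, inner_sub_right] at hx
    rw [hb]
    norm_cast at hx ⊢
    linarith
  intro u
  calc conjugate φ y + ((inner ℝ z (u - y) : ℝ) : EReal)
      ≤ ((inner ℝ y z - a : ℝ) : EReal) + ((inner ℝ z (u - y) : ℝ) : EReal) := by gcongr
    _ = ((inner ℝ u z : ℝ) : EReal) - φ z := by
        rw [ha, inner_sub_right, real_inner_comm z u, real_inner_comm z y]
        norm_cast
        ring
    _ ≤ conjugate φ u := le_iSup (fun x => ((inner ℝ u x : ℝ) : EReal) - φ x) z

lemma mem_posTangentConeAt_of_quadraticGrowth {Y : Type*} [NormedAddCommGroup Y]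
    [InnerProductSpace ℝ Y] {g : Y → EReal} {y₀ v w : Y} {a : ℝ} (ha : g y₀ = a)
    (hv : v ∈ subdifferential g y₀) (hQG : QuadraticGrowth g y₀ v)
    {t : ℕ → ℝ} {ws : ℕ → Y} {r : ℕ → ℝ} (ht : ∀ n, 0 < t n)
    (ht0 : Tendsto t atTop (𝓝 0)) (hws : Tendsto ws atTop (𝓝 w))
    (hr : Tendsto r atTop (𝓝 0))
    (hb : ∀ᶠ n in atTop, g (y₀ + t n • ws n) ≤
        ((a + t n * inner ℝ v (ws n) + t n ^ 2 * r n : ℝ) : EReal)) :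
    w ∈ posTangentConeAt {z | v ∈ subdifferential g z} y₀ := by
  obtain ⟨c, hc, ε, hε, hgrow⟩ := hQG
  set Z := {z | v ∈ subdifferential g z} with hZ
  -- Near-projections onto Z suffice: their error t_n² is o(t_n).
  have hZne : Z.Nonempty := ⟨y₀, hv⟩
  have hch : ∀ n, ∃ z ∈ Z, dist (y₀ + t n • ws n) z <
      Metric.infDist (y₀ + t n • ws n) Z + t n ^ 2 := fun n =>
    (Metric.infDist_lt_iff hZne).1 (lt_add_of_pos_right _ (pow_pos (ht n) 2))
  choose z hzZ hzd using hch
  have htw : Tendsto (fun n => t n • ws n) atTop (𝓝 0) := by simpa using ht0.smul hws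
  have hylim : Tendsto (fun n => y₀ + t n • ws n) atTop (𝓝 y₀) := by
    simpa using htw.const_add y₀
  have hdist : ∀ᶠ n in atTop, Metric.infDist (y₀ + t n • ws n) Z ≤ t n * √(2 / c * r n) := by
    filter_upwards [hb, hylim.eventually (Metric.ball_mem_nhds y₀ hε)] with n hn hball
    have h1 := (hgrow _ hball).trans hn
    rw [ha, add_sub_cancel_left, inner_smul_right] at h1
    norm_cast at h1
    have h2 : Metric.infDist (y₀ + t n • ws n) Z ^ 2 ≤ t n ^ 2 * (2 / c * r n) := by
      have : c / 2 * Metric.infDist (y₀ + t n • ws n) Z ^ 2 ≤ t n ^ 2 * r n := by linarith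
      calc _ = 2 / c * (c / 2 * Metric.infDist (y₀ + t n • ws n) Z ^ 2) := by field_simp
        _ ≤ 2 / c * (t n ^ 2 * r n) := by gcongr
        _ = _ := by ring
    calc _ ≤ √(t n ^ 2 * (2 / c * r n)) := Real.le_sqrt_of_sq_le h2
      _ = _ := by rw [Real.sqrt_mul (by positivity), Real.sqrt_sq (ht n).le]
  have herr : Tendsto (fun n => (t n)⁻¹ • (z n - (y₀ + t n • ws n))) atTop (𝓝 0) := by
    have hlim : Tendsto (fun n => √(2 / c * r n) + t n) atTop (𝓝 0) := by
      simpa using ((hr.const_mul (2 / c)).sqrt).add ht0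
    refine squeeze_zero_norm' ?_ hlim
    filter_upwards [hdist] with n hn
    rw [norm_smul, norm_inv, Real.norm_of_nonneg (ht n).le, inv_mul_le_iff₀ (ht n),
      ← dist_eq_norm, dist_comm]
    calc _ ≤ _ := (hzd n).le
      _ ≤ t n * √(2 / c * r n) + t n ^ 2 := by gcongr
      _ = _ := by ring
  have hquot : Tendsto (fun n => (t n)⁻¹ • (z n - y₀)) atTop (𝓝 w) := by
    have := herr.add hws
    rw [zero_add] at this
    refine this.congr fun n => ?_
    rw [← sub_sub, smul_sub, inv_smul_smul₀ (ht n).ne', sub_add_cancel]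
  refine mem_tangentConeAt_of_seq atTop (fun n => Real.toNNReal (t n)⁻¹) (fun n => z n - y₀)
    ?_ (Eventually.of_forall fun n => by simpa using hzZ n) ?_
  · have := ht0.smul hquot
    rw [zero_smul] at this
    exact this.congr fun n => smul_inv_smul₀ (ht n).ne' _
  · refine hquot.congr fun n => ?_
    rw [NNReal.smul_def, Real.coe_toNNReal _ (inv_pos.2 (ht n)).le]

end CompositeCalm

open CompositeCalm
theorem theorem4p1 {X Y P : Type*}
    [NormedAddCommGroup X] [InnerProductSpace ℝ X] [FiniteDimensional ℝ X]
    [NormedAddCommGroup Y] [InnerProductSpace ℝ Y] [FiniteDimensional ℝ Y]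
    [NormedAddCommGroup P] [InnerProductSpace ℝ P] [FiniteDimensional ℝ P]
    (f : X → P → ℝ) (g : Y → EReal) (K : X →ₗ[ℝ] Y) (x₀ : X) (p₀ : P)
    (hfconv : ∀ p, ConvexOn ℝ Set.univ (fun x => f x p))
    (hfC2 : ContDiffAt ℝ 2 (fun q : X × P => f q.1 q.2) (x₀, p₀))
    (hg : ProperLscConvex g)
    (hx₀ : x₀ ∈ solutionMap f g K p₀)
    (hRCQ : RobinsonCQ g K x₀) :
    ((LinearMap.ker (hessXX f x₀ p₀ : X →ₗ[ℝ] X) : Set X) ∩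
          kerSecondSubderiv (fun x => g (K x)) x₀ (-gradX f x₀ p₀) = {0} →
        IsolatedCalm (solutionMap f g K) p₀ x₀) ∧
    (∀ y₀ ∈ subdifferential g (K x₀),
        LinearMap.adjoint K y₀ = -gradX f x₀ p₀ →
        QuadraticGrowth g (K x₀) y₀ →
        (LinearMap.ker (hessXX f x₀ p₀ : X →ₗ[ℝ] X) : Set X) ∩
          K ⁻¹' posTangentConeAt (subdifferential (conjugate g) y₀) (K x₀) = {0} →
        IsolatedCalm (solutionMap f g K) p₀ x₀) := by
  have hbot : ∀ x, g (K x) ≠ ⊥ := fun x => hg.ne_bot _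
  have hconv : Convex ℝ {q : X × ℝ | g (K q.1) ≤ (q.2 : EReal)} :=
    hg.convex.linear_preimage (K.prodMap (LinearMap.id : ℝ →ₗ[ℝ] ℝ))
  obtain ⟨a, ha⟩ := exists_coe_eq_of_mem_argmin (h := fun x => g (K x)) hbot hx₀
  have hv : -gradX f x₀ p₀ ∈ subdifferential (fun x => g (K x)) x₀ :=
    neg_gradX_mem_subdifferential hbot hconv
      (differentiableAt_left (eventually_differentiableAt hfC2).self_of_nhds) hx₀
  refine ⟨fun hker => ?_, fun y₀ hy₀ hK hQG hker => ?_⟩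
  all_goals
    by_contra hS
    obtain ⟨w, t, ws, ps, hw, ht, ht0, hws, hps, hmem⟩ := exists_seq_of_not_isolatedCalm hx₀ hS
    obtain ⟨hHw, r, hr, hb⟩ := hessXX_apply_eq_zero_and_second_order_bound (hfconv p₀) hfC2
      hbot hconv ha hv ht ht0 hws hps hmem
    refine hw (hker.subset ⟨hHw, ?_⟩)
  · exact mem_kerSecondSubderiv_of_second_order_bound ha hv ht ht0 hws hr hb
  · refine posTangentConeAt_mono
      (fun z hz => mem_subdifferential_conjugate hg.ne_bot hg.exists_ne_top hz) ?_
    refine mem_posTangentConeAt_of_quadraticGrowth ha hy₀ hQG ht ht0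
      ((K.continuous_of_finiteDimensional.tendsto w).comp hws) hr ?_
    -- Since v = K*y₀, the linear term ⟨v, w_n⟩ equals ⟨y₀, Kw_n⟩, so the bound on h is one on g at
    -- Kx₀.
    simpa only [← hK, LinearMap.adjoint_inner_left, map_add, map_smul, Function.comp_apply] using hb
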